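/- Let $D$ be any Dedekind domain and let $H$ be a subgroup of finite index $n$ in $SL_2(D)$ which is a congruence subgroup, i.e. $H$ contains $\{X\in SL_2(D): X\equiv I_2 \pmod{\mathfrak q'}\}$ for some non-zero ideal $\mathfrak q'$ of $D$. The level $l(H)$ of $H$ is the largest ideal $\mathfrak q$ of $D$ such that $H$ contains the normal subgroup of $SL_2(D)$ generated by all matrices $\begin{pmatrix}1&a\\0&1\end{pmatrix}$ with $a\in\mathfrak q$. Suppose that $\mathfrak q=l(H)$ satisfies Condition L: $\mathfrak q\neq 0$, $\mathfrak q+(2)=D$, and there is no prime ideal $\mathfrak p$ of $D$ with $|D/\mathfrak p|=3$ and $\mathrm{ord}_{\mathfrak p}(\mathfrak q)=1$. Then $D/l(H)$ is finite and $|D/l(H)|$ divides $n!$; if moreover $H$ is a normal subgroup of $SL_2(D)$, then $|D/l(H)|$ divides $n$. -/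

import Mathlib

open scoped Nat MatrixGroups

namespace SL2

/-- The translation matrix `T(r)` with rows `(1, r)` and `(0, 1)`. -/
def T {R : Type*} [CommRing R] (r : R) : SL(2, R) :=
  ⟨!![1, r; 0, 1], by simp [Matrix.det_fin_two_of]⟩

/-- The normal subgroup of `SL₂(R)` generated by all `T(r)` with `r ∈ q`. -/
def NE2 {R : Type*} [CommRing R] (q : Ideal R) : Subgroup SL(2, R) :=
  Subgroup.normalClosure {X | ∃ r ∈ q, X = T r}

/-- The principal congruence subgroup `SL₂(R, q)`: the matrices congruent to the identity
modulo `q`. -/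
def principal {R : Type*} [CommRing R] (q : Ideal R) : Subgroup SL(2, R) :=
  (Matrix.SpecialLinearGroup.map (n := Fin 2) (Ideal.Quotient.mk q)).ker

/-- A congruence subgroup contains `SL₂(R, q)` for some nonzero ideal `q`. -/
def IsCongruence {R : Type*} [CommRing R] (H : Subgroup SL(2, R)) : Prop :=
  ∃ q : Ideal R, q ≠ ⊥ ∧ principal q ≤ H

/-- The level of `H`: the largest ideal `q` with `NE2 q ≤ H` (see `isGreatest_level`). -/
def level {R : Type*} [CommRing R] (H : Subgroup SL(2, R)) : Ideal R :=
  sSup {q : Ideal R | NE2 q ≤ H}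

theorem T_add {R : Type*} [CommRing R] (r s : R) : T (r + s) = T r * T s := by
  apply Subtype.ext
  rw [Matrix.SpecialLinearGroup.coe_mul]
  simp [T, add_comm]

theorem T_zero {R : Type*} [CommRing R] : T (0 : R) = 1 := by
  ext i j
  fin_cases i <;> fin_cases j <;> simp [T]

theorem NE2_le_iff {R : Type*} [CommRing R] (q : Ideal R) (H : Subgroup SL(2, R)) :
    NE2 q ≤ H ↔ ∀ r ∈ q, T r ∈ H.normalCore := by
  rw [NE2, ← Subgroup.normal_le_normalCore]
  constructor
  · intro h r hr
    exact h (Subgroup.subset_normalClosure ⟨r, hr, rfl⟩)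
  · intro h
    apply Subgroup.normalClosure_le_normal
    rintro X ⟨r, hr, rfl⟩
    exact h r hr

/-- The supremum defining the level is attained. -/
theorem isGreatest_level {R : Type*} [CommRing R] (H : Subgroup SL(2, R)) :
    IsGreatest {q : Ideal R | NE2 q ≤ H} (level H) := by
  refine ⟨?_, fun q hq => le_sSup hq⟩
  refine (NE2_le_iff _ H).2 ?_
  intro r hr
  rw [level, sSup_eq_iSup'] at hr
  induction hr using Submodule.iSup_induction' with
  | mem q x hx => exact (NE2_le_iff q.1 H).1 q.2 x hx
  | zero => rw [T_zero]; exact one_mem _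
  | add x y _ _ hx hy => rw [T_add]; exact mul_mem hx hy

/-- Condition L on an ideal `q`: it is nonzero and comaximal with `(2)`, and there is no prime
ideal `p` with `|D/p| = 3` whose exponent in the factorization of `q` is exactly one. -/
def ConditionL {D : Type*} [CommRing D] (q : Ideal D) : Prop :=
  q ≠ ⊥ ∧ q ⊔ Ideal.span {2} = ⊤ ∧
    ¬ ∃ p : Ideal D, p.IsPrime ∧ Nat.card (D ⧸ p) = 3 ∧ emultiplicity p q = 1

end SL2

/-! For normal `N` with level q, the point is that `T r ∈ N` forces r ∈ q; then D/q embeds in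
SL₂(D)/N and its order divides the index. A general H is replaced by its normal core, which has the
same level and index dividing n!.

The set of r with `T r ∈ N` is an additive group; it must be shown to be an ideal (`mem_of_T_mem`).
If r ∉ q, choose a maximal p ⊇ (q : r) and work modulo an ideal I with `principal I ≤ N`, where an
idempotent e isolates p. Diagonal conjugation scales translations by squares of units, and
differences of squares give 4e(x² - 1)r ∈ q for x ∉ p. Hence x² - 1 ∈ p, so D/p has 3 elements, and
Condition L gives q ≤ p². This forces r ∈ p and er² ∈ q; commutators with lower translations then
give 8e²r ∈ q, although 8e² ∉ p. -/

open Subgroup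

namespace SL2

/-! ### Subgroups normalized by elementary matrices -/

section CommRing

variable {S : Type*} [CommRing S]

/-- The lower translation matrix with rows `(1, 0)` and `(r, 1)`. -/
def L (r : S) : SL(2, S) :=
  ⟨!![1, 0; r, 1], by simp [Matrix.det_fin_two_of]⟩

theorem coe_T (r : S) : (T r : Matrix (Fin 2) (Fin 2) S) = !![1, r; 0, 1] := rfl

theorem coe_L (r : S) : (L r : Matrix (Fin 2) (Fin 2) S) = !![1, 0; r, 1] := rfl

theorem T_neg (r : S) : T (-r) = (T r)⁻¹ := by
  rw [eq_inv_iff_mul_eq_one, ← T_add, neg_add_cancel, T_zero]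

theorem T_sub (r s : S) : T (r - s) = T r * (T s)⁻¹ := by
  rw [sub_eq_add_neg, T_add, T_neg]

theorem L_add (r s : S) : L (r + s) = L r * L s := by
  apply Subtype.ext
  rw [Matrix.SpecialLinearGroup.coe_mul]
  simp [L]

theorem L_zero : L (0 : S) = 1 := by
  ext i j
  fin_cases i <;> fin_cases j <;> simp [L]

theorem L_neg (r : S) : L (-r) = (L r)⁻¹ := by
  rw [eq_inv_iff_mul_eq_one, ← L_add, neg_add_cancel, L_zero]

/-- The diagonal matrix with entries `u` and `v`, where `u * v = 1`. -/
def diag (u v : S) (h : u * v = 1) : SL(2, S) :=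
  ⟨!![u, 0; 0, v], by simp [Matrix.det_fin_two_of, h]⟩

theorem coe_diag (u v : S) (h : u * v = 1) :
    (diag u v h : Matrix (Fin 2) (Fin 2) S) = !![u, 0; 0, v] := rfl

theorem diag_eq (u v : S) (h : u * v = 1) :
    diag u v h = T u * L (-v) * T u * (T (-1) * L 1 * T (-1)) := by
  apply Subtype.ext
  simp only [Matrix.SpecialLinearGroup.coe_mul, coe_T, coe_L, coe_diag, Matrix.mul_fin_two]
  ext i j
  fin_cases i <;> fin_cases j <;> simp <;> grind

theorem diag_mul_T (u v r : S) (h : u * v = 1) :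
    diag u v h * T r = T (u ^ 2 * r) * diag u v h := by
  apply Subtype.ext
  simp only [Matrix.SpecialLinearGroup.coe_mul, coe_T, coe_diag, Matrix.mul_fin_two]
  ext i j
  fin_cases i <;> fin_cases j <;> simp
  grind

theorem weyl_mul_L (r : S) :
    (T 1 * L (-1) * T 1) * L r = T (-r) * (T 1 * L (-1) * T 1) := by
  apply Subtype.ext
  simp only [Matrix.SpecialLinearGroup.coe_mul, coe_T, coe_L, Matrix.mul_fin_two]
  ext i j
  fin_cases i <;> fin_cases j <;> simp

variable {M : Subgroup SL(2, S)}

theorem conj_mem {g x y : SL(2, S)} (hg : g ∈ normalizer (M : Set SL(2, S))) (h : g * x = y * g)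
    (hx : x ∈ M) : y ∈ M := by
  have := (mem_normalizer_iff.1 hg x).1 hx
  rwa [h, mul_inv_cancel_right] at this

theorem mem_of_conj_mem {g x y : SL(2, S)} (hg : g ∈ normalizer (M : Set SL(2, S)))
    (h : g * x = y * g) (hy : y ∈ M) : x ∈ M := by
  rw [mem_normalizer_iff.1 hg x, h, mul_inv_cancel_right]
  exact hy



theorem T_sq_mul_mem (hT : ∀ s : S, T s ∈ normalizer (M : Set SL(2, S)))
    (hL : ∀ s : S, L s ∈ normalizer (M : Set SL(2, S))) {u v r : S} (h : u * v = 1)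
    (hr : T r ∈ M) : T (u ^ 2 * r) ∈ M := by
  refine conj_mem ?_ (diag_mul_T u v r h) hr
  rw [diag_eq]
  exact mul_mem (mul_mem (mul_mem (hT _) (hL _)) (hT _))
    (mul_mem (mul_mem (hT _) (hL _)) (hT _))

theorem weyl_mem_normalizer (hT : ∀ s : S, T s ∈ normalizer (M : Set SL(2, S)))
    (hL : ∀ s : S, L s ∈ normalizer (M : Set SL(2, S))) :
    T 1 * L (-1) * T 1 ∈ normalizer (M : Set SL(2, S)) :=
  mul_mem (mul_mem (hT _) (hL _)) (hT _)

theorem L_mem_iff (hT : ∀ s : S, T s ∈ normalizer (M : Set SL(2, S)))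
    (hL : ∀ s : S, L s ∈ normalizer (M : Set SL(2, S))) {r : S} : L r ∈ M ↔ T r ∈ M := by
  rw [← inv_mem_iff (x := T r), ← T_neg]
  exact ⟨conj_mem (weyl_mem_normalizer hT hL) (weyl_mul_L r),
    mem_of_conj_mem (weyl_mem_normalizer hT hL) (weyl_mul_L r)⟩

/-- If `v` is invertible on the component cut out by the idempotent `e`, then translations
supported on that component may be scaled by `v ^ 2`. -/
theorem T_sq_mul_mem_of_idempotent (hT : ∀ s : S, T s ∈ normalizer (M : Set SL(2, S)))
    (hL : ∀ s : S, L s ∈ normalizer (M : Set SL(2, S))) {e v w r : S} (he : e * e = e)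
    (hv : e * (v * w) = e) (her : e * r = r) (hr : T r ∈ M) : T (v ^ 2 * r) ∈ M := by
  have := T_sq_mul_mem hT hL (u := 1 - e + e * v) (v := 1 - e + e * w)
    (by linear_combination (1 - v - w + v * w) * he + hv) hr
  convert this using 2
  linear_combination ((v + 1 - e + e * v) * (1 - v)) * her

theorem T_sq_sub_one_mul_mem (hT : ∀ s : S, T s ∈ normalizer (M : Set SL(2, S)))
    (hL : ∀ s : S, L s ∈ normalizer (M : Set SL(2, S))) {e v w r : S} (he : e * e = e)
    (hv : e * (v * w) = e) (hr : T r ∈ M) : T (e * (v ^ 2 - 1) * r) ∈ M := by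
  have := T_sq_mul_mem hT hL (u := 1 - e + e * v) (v := 1 - e + e * w)
    (by linear_combination (1 - v - w + v * w) * he + hv) hr
  have h2 := mul_mem this (inv_mem hr)
  rw [← T_sub] at h2
  convert h2 using 2
  linear_combination (-(1 - v) ^ 2 * r) * he

/-- A matrix congruent to the identity modulo an ideal of translations, with invertible upper left
entry, belongs to every subgroup normalized by the elementary matrices that contains these
translations. -/
theorem mem_of_congr_one (hT : ∀ s : S, T s ∈ normalizer (M : Set SL(2, S)))
    (hL : ∀ s : S, L s ∈ normalizer (M : Set SL(2, S))) {I : Ideal S}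
    (hI : ∀ r ∈ I, T r ∈ M) {X : SL(2, S)} (h00 : X 0 0 - 1 ∈ I) (h01 : X 0 1 ∈ I)
    (h10 : X 1 0 ∈ I) {A : S} (hA : X 0 0 * A = 1) : X ∈ M := by
  set i := X 0 0 - 1 with hi
  have hdet : X 0 0 * X 1 1 - X 0 1 * X 1 0 = 1 := by
    rw [← Matrix.det_fin_two]; exact X.2
  have hY : T 1 * L i * (T 1)⁻¹ ∈ M :=
    (mem_normalizer_iff.1 (hT 1) _).1 ((L_mem_iff hT hL).2 (hI _ h00))
  -- The middle factor has rows (1 + i, -i) and (i, 1 - i), so it shares the unit corner of X; one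
  -- row and one column operation correct the rest.
  have key : X = L ((X 1 0 - i) * A) * (T 1 * L i * (T 1)⁻¹) * T ((X 0 1 + i) * A) := by
    rw [← T_neg]
    apply Subtype.ext
    simp only [Matrix.SpecialLinearGroup.coe_mul, coe_T, coe_L, Matrix.mul_fin_two]
    ext a b
    fin_cases a <;> fin_cases b <;> simp <;> grind
  rw [key]
  exact mul_mem (mul_mem ((L_mem_iff hT hL).2 (hI _ (I.mul_mem_right _ (sub_mem h10 h00)))) hY)
    (hI _ (I.mul_mem_right _ (add_mem h01 h00)))

/-- Multiplying the commutators of `T r` with `L c` and `L (-c)` cancels the first-order terms in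
rc, leaving `L (2 * r * c ^ 2)` modulo (rc)². Nilpotency makes the corner entry a unit. -/
theorem T_two_mul_mem (hT : ∀ s : S, T s ∈ normalizer (M : Set SL(2, S)))
    (hL : ∀ s : S, L s ∈ normalizer (M : Set SL(2, S))) {I : Ideal S}
    (hI : ∀ r ∈ I, T r ∈ M) {r c : S} (hr : T r ∈ M) (hc : (r * c) ^ 2 ∈ I)
    (hnil : IsNilpotent (r * c)) : T (2 * r * c ^ 2) ∈ M := by
  have comm (c : S) : T r * (L c * (T r)⁻¹ * (L c)⁻¹) ∈ M :=
    mul_mem hr ((mem_normalizer_iff.1 (hL c) _).1 (inv_mem hr))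
  set P := T r * (L c * (T r)⁻¹ * (L c)⁻¹) * (T r * (L (-c) * (T r)⁻¹ * (L (-c))⁻¹)) with hP
  have hPM : P ∈ M := mul_mem (comm c) (comm (-c))
  have hval : ((L (-(2 * r * c ^ 2)) * P : SL(2, S)) : Matrix (Fin 2) (Fin 2) S) =
      !![1 + (r * c) ^ 2 * (1 - r * c + (r * c) ^ 2), (r * c) ^ 2 * (r * (r * c));
        (r * c) ^ 2 * (c * (-2 - r * c + 2 * (r * c) ^ 2 - 2 * (r * c) ^ 3)),
        1 - (r * c) ^ 2 + (r * c) ^ 3 - 2 * (r * c) ^ 5] := by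
    rw [hP]
    simp only [← T_neg, ← L_neg, Matrix.SpecialLinearGroup.coe_mul, coe_T, coe_L, Matrix.mul_fin_two]
    ext a b
    fin_cases a <;> fin_cases b <;> simp <;> ring
  have hX : L (-(2 * r * c ^ 2)) * P ∈ M := by
    have hunit : IsUnit (1 + (r * c) ^ 2 * (1 - r * c + (r * c) ^ 2)) := by
      apply IsNilpotent.isUnit_one_add
      rw [sq, mul_assoc]
      exact Commute.isNilpotent_mul_right (Commute.all _ _) hnil
    obtain ⟨A, hA⟩ := hunit.exists_right_inv
    refine mem_of_congr_one hT hL hI (A := A) ?_ ?_ ?_ ?_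
    all_goals
      simp only [hval]
      simp
    · exact I.mul_mem_right _ hc
    · exact I.mul_mem_right _ hc
    · exact I.mul_mem_right _ hc
    · exact hA
  rw [mul_mem_cancel_right hPM, L_neg, inv_mem_iff] at hX
  exact (L_mem_iff hT hL).1 hX

end CommRing

/-! ### Transfer to R/I, where idempotents are available -/

section Quotient

variable {R S : Type*} [CommRing R] [CommRing S]

theorem map_T (f : R →+* S) (r : R) : Matrix.SpecialLinearGroup.map f (T r) = T (f r) := by
  ext i j
  fin_cases i <;> fin_cases j <;> simp [coe_T]

theorem map_L (f : R →+* S) (r : R) : Matrix.SpecialLinearGroup.map f (L r) = L (f r) := by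
  ext i j
  fin_cases i <;> fin_cases j <;> simp [coe_L]

/-- The image of a subgroup of `SL₂(R)` in `SL₂(R ⧸ I)`. -/
def reduction (I : Ideal R) (N : Subgroup SL(2, R)) : Subgroup SL(2, R ⧸ I) :=
  N.map (Matrix.SpecialLinearGroup.map (Ideal.Quotient.mk I))

variable {I : Ideal R} {N : Subgroup SL(2, R)}

/-- Membership is not blurred by reduction, because N contains its kernel. -/
theorem T_mem_reduction_iff (h : principal I ≤ N) {r : R} :
    T (Ideal.Quotient.mk I r) ∈ reduction I N ↔ T r ∈ N := by
  rw [← map_T]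
  refine ⟨fun hr => ?_, fun hr => mem_map_of_mem _ hr⟩
  obtain ⟨X, hX, hXr⟩ := hr
  have : X⁻¹ * T r ∈ principal I := by
    rw [principal, MonoidHom.mem_ker, map_mul, map_inv, hXr, inv_mul_cancel]
  exact (mul_mem_cancel_left (inv_mem hX)).1 (h this)

theorem T_mem_normalizer_reduction [N.Normal] (s : R ⧸ I) :
    T s ∈ normalizer (reduction I N : Set SL(2, R ⧸ I)) := by
  obtain ⟨r, rfl⟩ := Ideal.Quotient.mk_surjective s
  rw [← map_T]
  exact le_normalizer_map _ (mem_map_of_mem _ (by rw [normalizer_eq_top]; trivial))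

theorem L_mem_normalizer_reduction [N.Normal] (s : R ⧸ I) :
    L s ∈ normalizer (reduction I N : Set SL(2, R ⧸ I)) := by
  obtain ⟨r, rfl⟩ := Ideal.Quotient.mk_surjective s
  rw [← map_L]
  exact le_normalizer_map _ (mem_map_of_mem _ (by rw [normalizer_eq_top]; trivial))

theorem T_sq_mul_mem_of_idempotent_mod [N.Normal] (h : principal I ≤ N) {e v w r : R}
    (he : e * e - e ∈ I) (hv : e * (v * w) - e ∈ I) (her : e * r - r ∈ I) (hr : T r ∈ N) :
    T (v ^ 2 * r) ∈ N := by
  rw [← T_mem_reduction_iff h] at hr ⊢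
  rw [← Ideal.Quotient.eq] at he hv her
  simp only [map_mul, map_pow] at he hv her ⊢
  exact T_sq_mul_mem_of_idempotent T_mem_normalizer_reduction L_mem_normalizer_reduction he hv her hr

theorem T_sq_sub_one_mul_mem_mod [N.Normal] (h : principal I ≤ N) {e v w r : R}
    (he : e * e - e ∈ I) (hv : e * (v * w) - e ∈ I) (hr : T r ∈ N) :
    T (e * (v ^ 2 - 1) * r) ∈ N := by
  rw [← T_mem_reduction_iff h] at hr ⊢
  rw [← Ideal.Quotient.eq] at he hv
  simp only [map_mul, map_pow, map_sub, map_one] at he hv ⊢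
  exact T_sq_sub_one_mul_mem T_mem_normalizer_reduction L_mem_normalizer_reduction he hv hr

theorem T_two_mul_mem_mod [N.Normal] (h : principal I ≤ N) {q : Ideal R}
    (hq : ∀ r ∈ q, T r ∈ N) {r c : R} {m : ℕ} (hr : T r ∈ N) (hc : (r * c) ^ 2 ∈ q)
    (hm : (r * c) ^ m ∈ I) : T (2 * r * c ^ 2) ∈ N := by
  rw [← T_mem_reduction_iff h] at hr ⊢
  have hI : ∀ s ∈ q.map (Ideal.Quotient.mk I), T s ∈ reduction I N := by
    intro s hs
    obtain ⟨t, ht, rfl⟩ := (Ideal.mem_map_iff_of_surjective _ Ideal.Quotient.mk_surjective).1 hs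
    exact (T_mem_reduction_iff h).2 (hq t ht)
  have := T_two_mul_mem T_mem_normalizer_reduction L_mem_normalizer_reduction hI
    (c := Ideal.Quotient.mk I c) hr
    (by simpa using Ideal.mem_map_of_mem (Ideal.Quotient.mk I) hc)
    ⟨m, by rw [← map_mul, ← map_pow]; exact Ideal.Quotient.eq_zero_iff_mem.2 hm⟩
  rwa [map_mul, map_mul, map_pow, map_ofNat]

end Quotient

theorem card_quotient_eq_three {R : Type*} [CommRing R] {p : Ideal R} [p.IsPrime]
    (h2 : (2 : R) ∉ p) (h : ∀ x ∉ p, x ^ 2 - 1 ∈ p) : Nat.card (R ⧸ p) = 3 := by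
  have h2' : (2 : R ⧸ p) ≠ 0 := by
    intro h0
    exact h2 (Ideal.Quotient.eq_zero_iff_mem.1 (by rw [map_ofNat, h0]))
  rw [← Set.ncard_univ, Set.ncard_eq_three]
  refine ⟨0, 1, -1, zero_ne_one, ?_, ?_, ?_⟩
  · rw [ne_comm, neg_ne_zero]
    exact one_ne_zero
  · intro h1
    apply h2'
    linear_combination h1
  · refine (Set.eq_univ_of_forall fun x => ?_).symm
    obtain ⟨x, rfl⟩ := Ideal.Quotient.mk_surjective x
    by_cases hx : x ∈ p
    · left
      exact Ideal.Quotient.eq_zero_iff_mem.2 hx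
    · right
      have hsq := Ideal.Quotient.eq_zero_iff_mem.2 (h x hx)
      rw [map_sub, map_pow, map_one, sub_eq_zero] at hsq
      simpa using sq_eq_sq_iff_eq_or_eq_neg.1 (hsq.trans (one_pow 2).symm)

/-! ### Localizing at a prime of a Dedekind domain -/

section Dedekind

variable {D : Type*} [CommRing D] [IsDedekindDomain D]

/-- For a nonzero ideal `I` inside a maximal ideal `p` there is an element outside `p` that is an
idempotent modulo `I` and cuts out the `p`-primary component of `D ⧸ I`. -/
theorem exists_local_idempotent {I p : Ideal D} [hp : p.IsMaximal] (hI : I ≠ ⊥) (hIp : I ≤ p) :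
    ∃ (e : D) (m : ℕ), e ∉ p ∧ e * e - e ∈ I ∧ (∀ z ∉ p, ∃ w, e * (z * w) - e ∈ I) ∧
      ∀ r ∈ p, ∀ y, (r * (e * y)) ^ m ∈ I := by
  have hp0 : p ≠ ⊥ := fun h => hI (le_bot_iff.1 (h ▸ hIp))
  have hpp : Prime p := Ideal.prime_of_isPrime hp0 hp.isPrime
  obtain ⟨b, hb, hpb⟩ :=
    (FiniteMultiplicity.of_prime_left hpp hI).exists_eq_pow_mul_and_not_dvd
  generalize multiplicity p I = m at hb
  have hcop (n : ℕ) {a : Ideal D} (ha : ¬ p ∣ a) : IsCoprime (p ^ n) a := by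
    apply IsCoprime.pow_left
    rw [Ideal.isCoprime_iff_sup_eq]
    exact hp.out.2 _ (left_lt_sup.2 fun h => ha (Ideal.dvd_iff_le.2 h))
  -- With I = pᵐb and p ∤ b, this e lies in b and is 1 modulo pᵐ.
  obtain ⟨t, ht, e, he, hte⟩ := Ideal.isCoprime_iff_exists.1 (hcop m hpb)
  have hmul {t x : D} (ht : t ∈ p ^ m) (hx : x ∈ b) : t * x ∈ I := by
    rw [hb]
    exact Ideal.mul_mem_mul ht hx
  obtain _ | k := m
  · exact absurd (Ideal.dvd_iff_le.2 hIp) (by simpa [hb] using hpb)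
  refine ⟨e, k + 1, ?_, ?_, ?_, ?_⟩
  · intro hep
    apply hp.ne_top
    rw [Ideal.eq_top_iff_one, ← hte]
    exact add_mem (Ideal.pow_le_self k.succ_ne_zero ht) hep
  · convert neg_mem (hmul ht he) using 1
    linear_combination e * hte
  · intro z hz
    obtain ⟨s, hs, x, hx, hsx⟩ := Ideal.isCoprime_iff_exists.1
      (hcop (k + 1) (a := Ideal.span {z})
        (by rwa [Ideal.dvd_span_singleton]))
    obtain ⟨w, rfl⟩ := Ideal.mem_span_singleton.1 hx
    refine ⟨w, ?_⟩
    convert neg_mem (hmul hs he) using 1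
    linear_combination e * hsx
  · intro r hr y
    rw [mul_pow, mul_pow, pow_succ e, mul_assoc]
    exact hmul (Ideal.pow_mem_pow hr _)
      (b.mul_mem_left _ (b.mul_mem_right _ he))

/-- Under condition L, the translations in a normal congruence subgroup form an ideal. -/
theorem mem_of_T_mem {N : Subgroup SL(2, D)} [N.Normal] (hN : IsCongruence N) {q : Ideal D}
    (hq : ∀ r ∈ q, T r ∈ N) (hmax : ∀ I : Ideal D, (∀ r ∈ I, T r ∈ N) → I ≤ q)
    (hL : ConditionL q) {r : D} (hr : T r ∈ N) : r ∈ q := by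
  obtain ⟨hq0, hq2, hq3⟩ := hL
  obtain ⟨I, hI0, hIN⟩ := hN
  by_contra hrq
  have hIq : I ≤ q := hmax I fun r hr =>
    hIN (by
      rw [principal, MonoidHom.mem_ker, map_T, Ideal.Quotient.eq_zero_iff_mem.2 hr, T_zero])
  -- p contains the colon ideal (q : r), so any d ∉ p with rd ∈ q is a contradiction.
  obtain ⟨p, hp, hJp⟩ := Ideal.exists_le_maximal (Submodule.comap (LinearMap.mulLeft D r) q)
    (by
      rw [Ne, Ideal.eq_top_iff_one]
      simpa using hrq)
  have hJ {d : D} (hd : r * d ∈ q) : d ∈ p := hJp hd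
  have hspan {d : D} (hd : ∀ y, T (d * y) ∈ N) : d ∈ q :=
    hmax (Ideal.span {d}) (fun x hx => by
      obtain ⟨y, rfl⟩ := Ideal.mem_span_singleton.1 hx
      exact hd y) (Ideal.mem_span_singleton_self d)
  have hqp : q ≤ p := fun d hd => hJ (q.mul_mem_left _ hd)
  have hp0 : p ≠ ⊥ := fun h => hq0 (le_bot_iff.1 (h ▸ hqp))
  have h2 : (2 : D) ∉ p := by
    intro h2
    apply hp.ne_top
    rw [← top_le_iff, ← hq2]
    exact sup_le hqp ((Ideal.span_singleton_le_iff_mem _).2 h2)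
  have hmul {x y : D} (hx : x ∉ p) (hy : y ∉ p) : x * y ∉ p := fun h =>
    (hp.isPrime.mem_or_mem h).elim hx hy
  have h4 : (4 : D) ∉ p := by
    convert hmul h2 h2 using 1
    norm_num
  obtain ⟨e, m, hep, hee, hinv, hnil⟩ := exists_local_idempotent hI0 (hIq.trans hqp)
  have hsq {x : D} (hx : x ∉ p) : 4 * (e * (x ^ 2 - 1) * r) ∈ q := by
    obtain ⟨w, hw⟩ := hinv x hx
    have hρ := T_sq_sub_one_mul_mem_mod hIN hee hw hr
    set ρ := e * (x ^ 2 - 1) * r with hρ_def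
    have heρ : e * ρ - ρ ∈ I := by
      convert I.mul_mem_right ((x ^ 2 - 1) * r) hee using 1
      rw [hρ_def]
      ring
    have hv {v : D} (hv : v ∉ p) : T (v ^ 2 * ρ) ∈ N := by
      obtain ⟨w, hw⟩ := hinv v hv
      exact T_sq_mul_mem_of_idempotent_mod hIN hee hw heρ hρ
    -- (y + 1)² - (y - 1)² = 4y; the residues y ≡ ±1 are reached below by shifting y by 1.
    have hdiff {y : D} (h₁ : y + 1 ∉ p) (h₂ : y - 1 ∉ p) : T (4 * ρ * y) ∈ N := by
      have := mul_mem (hv h₁) (inv_mem (hv h₂))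
      rw [← T_sub] at this
      convert this using 2
      ring
    have h1 : (1 : D) ∉ p := hp.isPrime.one_notMem
    have hmem {y : D} (hy : y ∈ p) : T (4 * ρ * y) ∈ N :=
      hdiff (fun h => h1 ((Ideal.add_mem_iff_right _ hy).1 h))
        (fun h => h1 (by simpa using sub_mem hy h))
    have h4ρ : T (4 * ρ) ∈ N := by
      convert hv h2 using 3
      norm_num
    apply hspan
    intro y
    by_cases h₁ : y + 1 ∈ p
    · have := mul_mem (hmem h₁) (inv_mem h4ρ)
      rw [← T_sub] at this
      convert this using 2
      ring
    by_cases h₂ : y - 1 ∈ p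
    · have := mul_mem (hmem h₂) h4ρ
      rw [← T_add] at this
      convert this using 2
      ring
    exact hdiff h₁ h₂
  have hcard : Nat.card (D ⧸ p) = 3 := by
    apply card_quotient_eq_three h2
    intro x hx
    have h := hJ (d := 4 * e * (x ^ 2 - 1)) (by
      convert hsq hx using 1
      ring)
    exact (hp.isPrime.mem_or_mem h).resolve_left (hmul h4 hep)
  have hone_add {x : D} (hx : x ∈ p) : 1 + x ∉ p := fun h =>
    hp.isPrime.one_notMem ((Ideal.add_mem_iff_left _ hx).1 h)
  have htwo_add {x : D} (hx : x ∈ p) : 2 + x ∉ p := fun h =>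
    h2 ((Ideal.add_mem_iff_left _ hx).1 h)
  have hqp2 : q ≤ p ^ 2 := by
    rw [← Ideal.dvd_iff_le]
    apply pow_dvd_of_le_emultiplicity
    have h1 : (1 : ℕ∞) ≤ emultiplicity p q := by
      have := le_emultiplicity_of_pow_dvd (a := p) (b := q) (k := 1)
        (by rw [pow_one]; exact Ideal.dvd_iff_le.2 hqp)
      exact_mod_cast this
    have hne : emultiplicity p q ≠ 1 := fun h => hq3 ⟨p, hp.isPrime, hcard, h⟩
    have := Order.add_one_le_of_lt (lt_of_le_of_ne h1 hne.symm)
    rw [one_add_one_eq_two] at this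
    exact_mod_cast this
  -- Otherwise, for x ∈ p outside p², the element 4e(2 + x)xr would have order 1 at p, yet it lies
  -- in q ≤ p².
  have hrp : r ∈ p := by
    obtain ⟨x, hx, hx2⟩ := Ideal.exists_mem_pow_notMem_pow_succ p hp0 hp.ne_top 1
    rw [pow_one] at hx
    by_contra hrp
    have hs : 4 * e * (2 + x) * r ∉ p := hmul (hmul (hmul h4 hep) (htwo_add hx)) hrp
    obtain ⟨w, t, ht, hwt⟩ := hp.exists_inv hs
    apply hx2
    have hmem : 4 * (e * ((1 + x) ^ 2 - 1) * r) ∈ p ^ 2 := hqp2 (hsq (hone_add hx))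
    have htx : t * x ∈ p ^ 2 := by
      rw [sq]
      exact Ideal.mul_mem_mul ht hx
    convert add_mem ((p ^ 2).mul_mem_left w hmem) htx using 1
    linear_combination (-x) * hwt
  -- Take x = 1 + r in `hsq`: x² - 1 = r(2 + r), and 4(2 + r) is invertible on the e-component.
  have her : e * r ^ 2 ∈ q := by
    obtain ⟨w, hw⟩ := hinv _ (hmul h4 (htwo_add hrp))
    convert sub_mem (q.mul_mem_left w (hsq (hone_add hrp)))
      (q.mul_mem_left (r ^ 2) (hIq hw)) using 1
    ring
  have htwo (y : D) : T (2 * r * (e * y) ^ 2) ∈ N := by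
    refine T_two_mul_mem_mod hIN hq hr ?_ (hnil r hrp y)
    convert q.mul_mem_left (e * y ^ 2) her using 1
    ring
  -- The same difference of squares turns y² into 4y, making the multiplier arbitrary.
  have h8 : r * (4 * 2 * (e * e)) ∈ q := by
    apply hspan
    intro y
    have := mul_mem (htwo (y + 1)) (inv_mem (htwo (y - 1)))
    rw [← T_sub] at this
    convert this using 2
    ring
  exact hmul (hmul h4 h2) (hmul hep hep) (hJ h8)

/-- Translations, as a homomorphism from the additive group of the ring. -/
def THom (R : Type*) [CommRing R] : Multiplicative R →* SL(2, R) where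
  toFun r := T r.toAdd
  map_one' := T_zero
  map_mul' _ _ := T_add _ _

theorem card_quotient_dvd_index {N : Subgroup SL(2, D)} [N.Normal] (hN : IsCongruence N)
    (hL : ConditionL (level N)) : Nat.card (D ⧸ level N) ∣ N.index := by
  have hiff (q : Ideal D) : NE2 q ≤ N ↔ ∀ r ∈ q, T r ∈ N := by
    rw [NE2_le_iff, normalCore_eq_self]
  have hgreat := isGreatest_level N
  have heq : N.comap (THom D) = AddSubgroup.toSubgroup (level N).toAddSubgroup := by
    ext r
    exact ⟨mem_of_T_mem hN ((hiff _).1 hgreat.1) (fun I hI => hgreat.2 ((hiff I).2 hI)) hL,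
      (hiff _).1 hgreat.1 r.toAdd⟩
  have hcard : Nat.card (D ⧸ level N) = (N.comap (THom D)).index := by
    rw [heq, AddSubgroup.index_toSubgroup]
    rfl
  rw [hcard, index_comap]
  exact relIndex_dvd_index_of_normal _ _

end Dedekind

theorem level_normalCore {R : Type*} [CommRing R] (H : Subgroup SL(2, R)) :
    level H.normalCore = level H := by
  simp only [level, NE2_le_iff, normalCore_idempotent]

theorem IsCongruence.normalCore {R : Type*} [CommRing R] {H : Subgroup SL(2, R)}
    (h : IsCongruence H) : IsCongruence H.normalCore := by
  obtain ⟨q, hq, hqH⟩ := h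
  refine ⟨q, hq, ?_⟩
  have : (principal q).Normal := MonoidHom.normal_ker _
  exact normal_le_normalCore.2 hqH

end SL2

/-- The action on the cosets of H embeds G modulo the core in a symmetric group. -/
theorem Subgroup.index_normalCore_dvd_factorial {G : Type*} [Group G] (H : Subgroup G)
    [H.FiniteIndex] : H.normalCore.index ∣ H.index ! := by
  rw [normalCore_eq_ker, index_ker, index_eq_card, ← Nat.card_perm]
  exact card_subgroup_dvd_card _

theorem theoremC {D : Type*} [CommRing D] [IsDedekindDomain D]
    (H : Subgroup SL(2, D)) (n : ℕ) (hn : n ≠ 0) (hindex : H.index = n)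
    (hcong : SL2.IsCongruence H) (hL : SL2.ConditionL (SL2.level H)) :
    Nat.card (D ⧸ SL2.level H) ∣ n ! ∧
      (H.Normal → Nat.card (D ⧸ SL2.level H) ∣ n) := by
  subst hindex
  constructor
  · have : H.FiniteIndex := ⟨hn⟩
    have h := SL2.card_quotient_dvd_index hcong.normalCore (by rwa [SL2.level_normalCore])
    rw [SL2.level_normalCore] at h
    exact h.trans H.index_normalCore_dvd_factorial
  · intro _
    exact SL2.card_quotient_dvd_index hcong hL
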